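/- **Setting.** Let $\mathcal I,\mathcal S,\mathcal M$ be finite sets of students, schools and student types, and let $\emptyset$ be the null school. Student $i$ has a type $\tau(i)\in\mathcal M$ and a score $\pi_{i,s}\in\mathbb N\cup\{0\}$ at each school $s$; scores of different students at a school differ. School $s$ has capacity $q_s$ and reserve quotas $q_s^m\ge 0$ $(m\in\mathcal M)$ with $\sum_m q_s^m<q_s$. An *(augmented) matching* $\mu$ either leaves a student unmatched ($\mu(i)=\emptyset$) or assigns her to a school $\mu(i)\in\mathcal S$ with a seat type $t_i^\mu\in\{r,o\}$ (reserved or open), such that each $s$ admits at most $q_s$ students and gives at most $q_s^m$ reserved seats to type-$m$ students. Let $\mu(s),\mu^o(s),\mu^{rm}(s)$ be the sets of students admitted to $s$, of those in open seats, and of type-$m$ students in reserved seats. The *cutoffs* at $s$ are $$c^m_s=\begin{cases}\min_{i\in\mu^{rm}(s)}\pi_{i,s}&\text{if }|\mu^{rm}(s)|=q^m_s>0,\\0&\text{if }|\mu^{rm}(s)|<q_s^m,\\+\infty&\text{if }q^m_s=0,\end{cases}\qquad c^o_s=\begin{cases}\min_{i\in\mu^o(s)}\pi_{i,s}&\text{if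 }|\mu(s)|=q_s,\\0&\text{otherwise.}\end{cases}$$ A school $s$ is *affordable* to $i$ if $\pi_{i,s}\ge\min\{c_s^{\tau(i)},c_s^o\}$; $\emptyset$ is always affordable. Each student has a strict preference $P_i$ over $\mathcal S\cup\{\emptyset\}$, with weak part $R_i$. Given $P=(P_i)_{i\in\mathcal I}$, $\mu$ is *RO-verifiable* (*OR-verifiable*) if every student $i$ is assigned to her $P_i$-best affordable element of $\mathcal S\cup\{\emptyset\}$ and every school follows the RO (OR) seat rule. The *RO seat rule* holds at $s$ if each $i\in\mu(s)$ has a reserved seat when $\pi_{i,s}\ge c_s^{\tau(i)}$ and an open seat otherwise; the *OR seat rule* holds at $s$ if each $i\in\mu(s)$ has an open seat when $\pi_{i,s}\ge c_s^{o}$ and a reserved seat otherwise. A *direct mechanism* $\psi$ maps each profile $P$ of strict preferences to a matching. It is *individually rational* if always $\psi_i(P)\,R_i\,\emptyset$, *strategy-proof* if always $\psi_i(P)\,R_i\,\psi_i(P_i',P_{-i})$, and *RO-verifiable* (*OR-verifiable*) if $\psi(P)$ is so for every $P$; it is *verifiable* if it is RO-verifiable or OR-verifiable. An *augmented choice rule*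 $\mathcal C_s$ of school $s$ maps each $I\subseteq\mathcal I$ to a matching $\mathcal C_s(I)$ in the economy consisting of $s$ and the students in $I$, who all find $s$ acceptable. It is *RO-verifiable* (*OR-verifiable*) if every $\mathcal C_s(I)$ is so in that economy, and *verifiable* if it is RO-verifiable or OR-verifiable. It is *substitutable* if, for all distinct $i,j\in I$, whenever $i$ is admitted in $\mathcal C_s(I)$, she is also admitted in $\mathcal C_s(I\setminus\{j\})$. **Deferred acceptance (DA).** In each round every student who is not tentatively admitted applies to her best acceptable school that has not yet rejected her. Then each school $s$ applies $\mathcal C_s$ to the set of all students who have applied to it so far (including those it has rejected), tentatively admitting those chosen, with the chosen seat types, and rejecting the others; a student rejected by a school is not admitted by it later. The algorithm stops when every student is admitted or has been rejected by all schools acceptable to her, and outputs the tentative matching. In *round-by-round DA*, school $s$ instead applies $\mathcal C_s$ in each round to its new applicants and the students it tentatively admitted in the previous round. **Lemma.** Suppose every school $s$ uses a substitutable and verifiable augmented choice rule $\mathcal C_s$. 1. The DA mechanism is individually rational and strategy-proof. 2. If all $\mathcal C_s$ are RO-verifiable, the DA mechanism is RO-verifiable; if all are OR-verifiable, it is OR-verifiable.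 Thus if all schools use the same kind of verifiable rule, it is verifiable. 3. In general, in every outcome of DA every student is assigned to her best affordable element of $\mathcal S\cup\{\emptyset\}$, and the RO (OR) seat rule holds at each school whose choice rule is RO-verifiable (OR-verifiable). 4. Round-by-round DA assigns every student to the same school as DA and is individually rational and strategy-proof. If all $\mathcal C_s$ are RO-verifiable, it yields the same augmented matchings as DA and is RO-verifiable. -/

import Mathlib

open Classical

universe u v w

/-- The two types of seats. -/
inductive SeatType where
  | reserved : SeatType
  | opened : SeatType

/-- A strict preference relation over `S ∪ {∅}`; the null school is `none`, and `rel x y` says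
that `x` is strictly preferred to `y`. -/
structure Pref (S : Type v) where
  rel : Option S → Option S → Prop
  strict : IsStrictTotalOrder (Option S) rel

/-- The weak preference `R` of a strict preference `P`. -/
def Pref.weak {S : Type v} (P : Pref S) (x y : Option S) : Prop := P.rel x y ∨ x = y

/-- A school `s` is acceptable if it is preferred to the null school. -/
def Pref.Acceptable {S : Type v} (P : Pref S) (s : S) : Prop := P.rel (some s) none

/-- `x` is the most preferred element of `A`. -/
def Pref.IsBest {S : Type v} (P : Pref S) (A : Set (Option S)) (x : Option S) : Prop :=
  x ∈ A ∧ ∀ y ∈ A, P.weak x y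

/-- With a single school, the preference that regards the school as acceptable. -/
def Pref.accept : Pref Unit where
  rel x y := x = some () ∧ y = none
  strict :=
    { trichotomous := by rintro (_ | ⟨⟨⟩⟩) (_ | ⟨⟨⟩⟩) <;> simp
      irrefl := by rintro x ⟨rfl, h⟩; simp at h
      trans := by rintro x y z ⟨h1, h2⟩ ⟨h3, h4⟩; exact ⟨h1, h4⟩ }

/-- The fixed data of a school choice problem with students `I`, schools `S` and student
types `M` (everything but the students' preferences). Student `i` has higher priority than `j` at
`s` iff `score j s < score i s`; priorities are strict. -/
structure Economy (I : Type u) (S : Type v) (M : Type w) [Fintype M] where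
  score : I → S → ℕ
  score_injective : ∀ s, Function.Injective fun i => score i s
  type : I → M
  capacity : S → ℕ
  reserve : S → M → ℕ
  reserve_lt : ∀ s, ∑ m, reserve s m < capacity s

section Matching

variable {I : Type u} {S : Type v} {M : Type w} [Fintype I] [Fintype M]

/-- An augmented matching: `seat i = some (s, t)` means that student `i` occupies a type-`t` seat
at school `s`, and `seat i = none` that `i` is unmatched (the seat type is then irrelevant). -/
structure AugMatching (E : Economy I S M) where
  seat : I → Option (S × SeatType)
  card_le_capacity : ∀ s, (Finset.univ.filter fun i => ∃ t, seat i = some (s, t)).card ≤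
    E.capacity s
  card_le_reserve : ∀ s m, (Finset.univ.filter fun i =>
    seat i = some (s, SeatType.reserved) ∧ E.type i = m).card ≤ E.reserve s m

namespace AugMatching

variable {E : Economy I S M} (μ : AugMatching E)

/-- The school of student `i` (`none` is the null school); as a function of `i`, this is the
standard matching induced by `μ`. -/
def school (i : I) : Option S := (μ.seat i).map Prod.fst

/-- `μ(s)`: the students admitted to `s`. -/
noncomputable def admitted (s : S) : Finset I :=
  Finset.univ.filter fun i => ∃ t, μ.seat i = some (s, t)

/-- The students occupying open seats at `s`. -/
noncomputable def openAt (s : S) : Finset I :=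
  Finset.univ.filter fun i => μ.seat i = some (s, SeatType.opened)

/-- The type-`m` students occupying reserved seats at `s`. -/
noncomputable def reservedAt (s : S) (m : M) : Finset I :=
  Finset.univ.filter fun i => μ.seat i = some (s, SeatType.reserved) ∧ E.type i = m

/-- The cutoff for the seats of `s` reserved for type `m`. -/
noncomputable def reservedCutoff (s : S) (m : M) : ℕ∞ :=
  if E.reserve s m = 0 then ⊤
  else if (μ.reservedAt s m).card = E.reserve s m then
    (μ.reservedAt s m).inf fun i => (E.score i s : ℕ∞)
  else 0

/-- The cutoff for the open seats of `s`. (At a full school some open seat is occupied, since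
the reserve quotas add up to less than the capacity, so the infimum is a minimum.) -/
noncomputable def openCutoff (s : S) : ℕ∞ :=
  if (μ.admitted s).card = E.capacity s then (μ.openAt s).inf fun i => (E.score i s : ℕ∞)
  else 0

/-- The schools affordable to `i`; the null school always is, its cutoffs being zero. -/
def affordable (i : I) : Set (Option S) :=
  {x | ∀ s, x = some s → min (μ.reservedCutoff s (E.type i)) (μ.openCutoff s) ≤ (E.score i s : ℕ∞)}

/-- Every student is at her most preferred affordable school. -/
def BestAffordable (P : I → Pref S) : Prop :=
  ∀ i, (P i).IsBest (μ.affordable i) (μ.school i)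

/-- At school `s`, an admitted student has a reserved seat if her score meets the cutoff for the
seats reserved for her type, and an open seat otherwise. -/
def ROSeatsAt (s : S) : Prop :=
  ∀ i t, μ.seat i = some (s, t) →
    t = if μ.reservedCutoff s (E.type i) ≤ (E.score i s : ℕ∞) then SeatType.reserved
      else SeatType.opened

/-- At school `s`, an admitted student has an open seat if her score meets the cutoff for open
seats, and a reserved seat otherwise. -/
def ORSeatsAt (s : S) : Prop :=
  ∀ i t, μ.seat i = some (s, t) →
    t = if μ.openCutoff s ≤ (E.score i s : ℕ∞) then SeatType.opened else SeatType.reserved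

def ROVerifiable (P : I → Pref S) : Prop := μ.BestAffordable P ∧ ∀ s, μ.ROSeatsAt s

def ORVerifiable (P : I → Pref S) : Prop := μ.BestAffordable P ∧ ∀ s, μ.ORSeatsAt s

/-- No student is assigned to an unacceptable school. -/
def IndividuallyRational (P : I → Pref S) : Prop := ∀ i, (P i).weak (μ.school i) none

end AugMatching

/-- A direct mechanism selects an augmented matching for every profile of strict preferences. -/
abbrev DirectMechanism (E : Economy I S M) : Type (max u v) := (I → Pref S) → AugMatching E

namespace DirectMechanism

variable {E : Economy I S M} (ψ : DirectMechanism E)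

def IndividuallyRational : Prop := ∀ P, (ψ P).IndividuallyRational P

def StrategyProof : Prop :=
  ∀ (P : I → Pref S) (i : I) (P' : Pref S),
    (P i).weak ((ψ P).school i) ((ψ (Function.update P i P')).school i)

def ROVerifiable : Prop := ∀ P, (ψ P).ROVerifiable P

def ORVerifiable : Prop := ∀ P, (ψ P).ORVerifiable P

end DirectMechanism

/-- The artificial economy consisting of the school `s` and the students in `A`. -/
def Economy.single (E : Economy I S M) (s : S) (A : Finset I) : Economy {i // i ∈ A} Unit M where
  score i _ := E.score i s
  score_injective _ := fun _ _ h => Subtype.ext (E.score_injective s h)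
  type i := E.type i
  capacity _ := E.capacity s
  reserve _ := E.reserve s
  reserve_lt _ := E.reserve_lt s

/-- An augmented choice rule for school `s`: for every set `A` of applicants, an augmented matching
in the artificial economy consisting of `s` and `A`. -/
def ChoiceRule (E : Economy I S M) (s : S) : Type u :=
  (A : Finset I) → AugMatching (E.single s A)

namespace ChoiceRule

variable {E : Economy I S M} {s : S} (C : ChoiceRule E s)

/-- The type of the seat of `i` in `C(A)`; `none` if `i` is not chosen from `A`. -/
noncomputable def seatType (A : Finset I) (i : I) : Option SeatType :=
  if h : i ∈ A then ((C A).seat ⟨i, h⟩).map Prod.snd else none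

/-- The induced standard choice rule: the set of students chosen from `A`. -/
noncomputable def chosen (A : Finset I) : Finset I :=
  Finset.univ.filter fun i => C.seatType A i ≠ none

def Substitutable : Prop :=
  ∀ (A : Finset I) (i j : I), i ∈ A → j ∈ A → i ≠ j → i ∈ C.chosen A → i ∈ C.chosen (A.erase j)

def ROVerifiable : Prop := ∀ A, (C A).ROVerifiable fun _ => Pref.accept

def ORVerifiable : Prop := ∀ A, (C A).ORVerifiable fun _ => Pref.accept

def Verifiable : Prop := C.ROVerifiable ∨ C.ORVerifiable

end ChoiceRule

end Matching

namespace DeferredAcceptance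

variable {I : Type u} {S : Type v} {M : Type w} [Fintype I] [Fintype S] [Fintype M]

/-- The best acceptable school among those that have not rejected the student (`rej` is the set of
schools that have); `none` if there is no such school. -/
noncomputable def target (P : Pref S) (rej : Finset S) : Option S :=
  if h : ∃ s, P.Acceptable s ∧ s ∉ rej ∧
      ∀ s', P.Acceptable s' → s' ∉ rej → P.weak (some s) (some s')
  then some h.choose else none

/-- The applicants among whom school `s` chooses in a round: the new applicants and the students
tentatively admitted by `s`. As a student is tentatively admitted by a school exactly as long as it
has not rejected her after she applied to it, these are the students whose target is `s`. -/
noncomputable def currentPool (P : I → Pref S) (rej : I → Finset S) (s : S) : Finset I :=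
  Finset.univ.filter fun i => target (P i) (rej i) = some s

/-- All students who have applied to `s` up to and including the current round: those above and
those whom `s` has rejected. -/
noncomputable def cumulativePool (P : I → Pref S) (rej : I → Finset S) (s : S) : Finset I :=
  Finset.univ.filter fun i => target (P i) (rej i) = some s ∨ s ∈ rej i

/-- What the algorithm has reached after a round: which schools have rejected each student, and the
tentative augmented matching. -/
structure State (E : Economy I S M) where
  rejectedBy : I → Finset S
  tentative : AugMatching E

def State.init (E : Economy I S M) : State E where
  rejectedBy _ := ∅
  tentative := ⟨fun _ => none, by simp, by simp⟩

variable {E : Economy I S M}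

/-- The tentative matching when every school `s` chooses from `pool s`, and keeps those chosen whose
current target it is. -/
noncomputable def assign (C : ∀ s, ChoiceRule E s) (pool : S → Finset I) (tgt : I → Option S) :
    AugMatching E where
  seat i := (tgt i).bind fun s => ((C s).seatType (pool s) i).map fun t => (s, t)
  card_le_capacity s := by
    refine le_trans ?_ ((C s (pool s)).card_le_capacity ())
    rw [← Finset.card_map (Function.Embedding.subtype _)]
    refine Finset.card_le_card ?_
    intro i hi
    simp only [Finset.mem_filter, Finset.mem_univ, true_and, Option.bind_eq_some_iff,
      Option.map_eq_some_iff, Prod.mk.injEq] at hi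
    obtain ⟨t, s', -, t', h, rfl, rfl⟩ := hi
    unfold ChoiceRule.seatType at h
    split at h
    · rename_i hA
      obtain ⟨⟨⟨⟩, t⟩, h1, rfl⟩ := Option.map_eq_some_iff.1 h
      simp only [Finset.mem_map, Finset.mem_filter, Finset.mem_univ, true_and]
      exact ⟨⟨i, hA⟩, ⟨t, h1⟩, rfl⟩
    · simp at h
  card_le_reserve s m := by
    refine le_trans ?_ ((C s (pool s)).card_le_reserve () m)
    rw [← Finset.card_map (Function.Embedding.subtype _)]
    refine Finset.card_le_card ?_
    intro i hi
    simp only [Finset.mem_filter, Finset.mem_univ, true_and, Option.bind_eq_some_iff,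
      Option.map_eq_some_iff, Prod.mk.injEq] at hi
    obtain ⟨⟨s', -, t', h, rfl, rfl⟩, hm⟩ := hi
    unfold ChoiceRule.seatType at h
    split at h
    · rename_i hA
      obtain ⟨⟨⟨⟩, t⟩, h1, h2⟩ := Option.map_eq_some_iff.1 h
      simp only at h2
      subst h2
      simp only [Finset.mem_map, Finset.mem_filter, Finset.mem_univ, true_and]
      exact ⟨⟨i, hA⟩, ⟨h1, hm⟩, rfl⟩
    · simp at h

/-- A way of forming the sets of applicants from the preferences and the rejections so far. -/
abbrev Pool (I : Type u) (S : Type v) : Type (max u v) :=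
  (I → Pref S) → (I → Finset S) → S → Finset I

/-- The algorithm stops when every student is admitted to some school or has been rejected by all
acceptable schools. -/
def Stopped (P : I → Pref S) (st : State E) : Prop :=
  ∀ i, st.tentative.seat i ≠ none ∨ target (P i) (st.rejectedBy i) = none

/-- One round: every student not tentatively admitted applies to her target, every school chooses
from its pool, and rejects those who are not chosen. -/
noncomputable def round (pool : Pool I S) (C : ∀ s, ChoiceRule E s) (P : I → Pref S)
    (st : State E) : State E where
  tentative := assign C (pool P st.rejectedBy) fun i => target (P i) (st.rejectedBy i)
  rejectedBy i := st.rejectedBy i ∪ Finset.univ.filter fun s =>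
    target (P i) (st.rejectedBy i) = some s ∧
      i ∉ (C s).chosen (pool P st.rejectedBy s)

/-- A round, unless the algorithm has stopped. -/
noncomputable def step (pool : Pool I S) (C : ∀ s, ChoiceRule E s) (P : I → Pref S)
    (st : State E) : State E :=
  if Stopped P st then st else round pool C P st

/-- The final state. Every round but the last has a rejection, so `|I| |S| + 1` rounds suffice
(see `run_stopped`). -/
noncomputable def run (pool : Pool I S) (C : ∀ s, ChoiceRule E s) (P : I → Pref S) : State E :=
  (step pool C P)^[Fintype.card I * Fintype.card S + 1] (State.init E)

theorem target_not_mem {P : Pref S} {rej : Finset S} {s : S} (h : target P rej = some s) :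
    s ∉ rej := by
  unfold target at h
  split at h
  · rename_i hx
    obtain rfl := Option.some.inj h
    exact hx.choose_spec.2.1
  · simp at h

theorem round_stopped_or (pool : Pool I S) (C : ∀ s, ChoiceRule E s) (P : I → Pref S)
    (st : State E) : Stopped P (round pool C P st) ∨
      ∑ i, (st.rejectedBy i).card < ∑ i, ((round pool C P st).rejectedBy i).card := by
  by_cases h : ∀ i, (round pool C P st).rejectedBy i = st.rejectedBy i
  · left
    intro i
    rw [h i]
    cases ht : target (P i) (st.rejectedBy i) with
    | none => exact Or.inr rfl
    | some s =>
      left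
      have h1 : i ∈ (C s).chosen (pool P st.rejectedBy s) := by
        by_contra hc
        refine target_not_mem ht ?_
        rw [← h i]
        simp [round, ht, hc]
      simp only [ChoiceRule.chosen, Finset.mem_filter, Finset.mem_univ, true_and] at h1
      simpa [round, assign, ht] using h1
  · right
    push Not at h
    obtain ⟨i, hi⟩ := h
    have hsub : ∀ j, st.rejectedBy j ⊆ (round pool C P st).rejectedBy j :=
      fun j => Finset.subset_union_left
    exact Finset.sum_lt_sum (fun j _ => Finset.card_le_card (hsub j))
      ⟨i, Finset.mem_univ i, Finset.card_lt_card ((hsub i).ssubset_of_ne hi.symm)⟩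

theorem run_stopped (pool : Pool I S) (C : ∀ s, ChoiceRule E s) (P : I → Pref S) :
    Stopped P (run pool C P) := by
  have key : ∀ n, Stopped P ((step pool C P)^[n] (State.init E)) ∨
      n ≤ ∑ i, (((step pool C P)^[n] (State.init E)).rejectedBy i).card := by
    intro n
    induction n with
    | zero => right; simp
    | succ n ih =>
      rw [Function.iterate_succ_apply']
      set st := (step pool C P)^[n] (State.init E)
      by_cases hs : Stopped P st
      · left; simp [step, hs]
      · have h2 := ih.resolve_left hs
        have h3 : step pool C P st = round pool C P st := by simp [step, hs]
        rw [h3]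
        rcases round_stopped_or pool C P st with h4 | h4
        · exact Or.inl h4
        · right; omega
  refine (key _).resolve_right fun h => ?_
  have hb : ∑ i, ((run pool C P).rejectedBy i).card ≤ ∑ _i : I, Fintype.card S :=
    Finset.sum_le_sum fun i _ => Finset.card_le_univ _
  simp only [Finset.sum_const, Finset.card_univ, smul_eq_mul] at hb
  have := h.trans hb
  omega

/-- Deferred acceptance in which every school, in each round, chooses from all the applications
received so far (cumulative offers). -/
noncomputable def cumulativeDA (C : ∀ s, ChoiceRule E s) : DirectMechanism E :=
  fun P => (run cumulativePool C P).tentative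

/-- Deferred acceptance in which every school, in each round, chooses from its new applicants and
the students it has tentatively admitted. -/
noncomputable def roundwiseDA (C : ∀ s, ChoiceRule E s) : DirectMechanism E :=
  fun P => (run currentPool C P).tentative

end DeferredAcceptance

/-! A family `rej` of rejection sets determines each student's target and each school's cumulative
pool. Pools grow with `rej` (`target_mono`). By substitutability, a student passed over in one pool
is passed over in every larger one, so rejections are never regretted (`RejectionsStand`); at
termination every target chooses its student (`TargetsChosen`). Each school's choice is then exactly
the set of students who target it, so DA carries over the matching of its one-school economy, with
the same cutoffs and seat rule. Schools better than a student's target have rejected her, hence have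
her in their pools, and a verifiable rule passes over exactly those applicants who cannot afford the
school.

Strategy-proofness rests on two facts. The rejections of DA are the least family satisfying
`TargetsChosen` (`finalRejections_subset`), and verifiable rules obey the law of aggregate demand,
since a school with an unfilled seat has open cutoff 0 and rejects nobody. Suppose that a misreport
gives `i` a school `s` better than her truthful assignment. Then ranking `s` alone also gives her
`s`, while truncating her true preference at `s` leaves her unmatched. Passing from the truncation
to `s` alone shrinks all pools, so no more students can be matched in total; yet nobody loses her
match and `i` gains one, a contradiction.

Substitutability and aggregate demand together make rejected applicants irrelevant, so the
round-by-round version rejects the same students. Under RO rules the set of admitted students also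
determines the seat types. -/

/-! ### Strict preferences and their truncations -/

theorem Pref.rel_trans {S : Type v} (P : Pref S) {x y z : Option S} (h : P.rel x y)
    (h' : P.rel y z) : P.rel x z := by
  have := P.strict
  exact trans_of P.rel h h'

theorem Pref.not_rel_self {S : Type v} (P : Pref S) (x : Option S) : ¬ P.rel x x := by
  have := P.strict
  exact irrefl_of P.rel x

theorem Pref.weak_or_rel {S : Type v} (P : Pref S) (x y : Option S) : P.weak x y ∨ P.rel y x := by
  have := P.strict
  rcases trichotomous_of P.rel x y with h | h | h
  · exact Or.inl (Or.inl h)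
  · exact Or.inl (Or.inr h)
  · exact Or.inr h

theorem Pref.weak_refl {S : Type v} (P : Pref S) (x : Option S) : P.weak x x := Or.inr rfl

theorem Pref.rel_of_weak_of_rel {S : Type v} (P : Pref S) {x y z : Option S} (h : P.weak x y)
    (h' : P.rel y z) : P.rel x z := by
  rcases h with h | rfl
  · exact P.rel_trans h h'
  · exact h'

theorem Pref.weak_trans {S : Type v} (P : Pref S) {x y z : Option S} (h : P.weak x y)
    (h' : P.weak y z) : P.weak x z := by
  rcases h' with h' | rfl
  · exact Or.inl (P.rel_of_weak_of_rel h h')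
  · exact h

theorem Pref.weak_antisymm {S : Type v} (P : Pref S) {x y : Option S} (h : P.weak x y)
    (h' : P.weak y x) : x = y := by
  rcases h with h | h
  · exact absurd (P.rel_of_weak_of_rel h' h) (P.not_rel_self _)
  · exact h

/-- The class of an alternative when the schools in `L` come first, then the null school, then the
remaining schools. -/
noncomputable def Pref.restrictClass {S : Type v} (L : Set S) : Option S → ℕ
  | none => 1
  | some s => if s ∈ L then 0 else 2

/-- The preference whose acceptable schools are those in `L`, ranked as before. -/
noncomputable def Pref.restrict {S : Type v} (P : Pref S) (L : Set S) : Pref S where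
  rel x y := Pref.restrictClass L x < Pref.restrictClass L y ∨
    Pref.restrictClass L x = Pref.restrictClass L y ∧ P.rel x y
  strict :=
    { trichotomous := by
        intro x y h h'
        rcases P.weak_or_rel x y with (h1 | h1) | h1
        · by_contra
          rcases lt_trichotomy (Pref.restrictClass L x) (Pref.restrictClass L y) with h2 | h2 | h2
          · exact h (Or.inl h2)
          · exact h (Or.inr ⟨h2, h1⟩)
          · exact h' (Or.inl h2)
        · exact h1
        · by_contra
          rcases lt_trichotomy (Pref.restrictClass L x) (Pref.restrictClass L y) with h2 | h2 | h2
          · exact h (Or.inl h2)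
          · exact h' (Or.inr ⟨h2.symm, h1⟩)
          · exact h' (Or.inl h2)
      irrefl := by
        rintro x (h | ⟨-, h⟩)
        · exact lt_irrefl _ h
        · exact P.not_rel_self x h
      trans := by
        rintro x y z (h | ⟨h, h1⟩) (h' | ⟨h', h1'⟩)
        · exact Or.inl (h.trans h')
        · exact Or.inl (h' ▸ h)
        · exact Or.inl (h ▸ h')
        · exact Or.inr ⟨h.trans h', P.rel_trans h1 h1'⟩ }

theorem Pref.restrict_acceptable {S : Type v} (P : Pref S) (L : Set S) (s : S) :
    (P.restrict L).Acceptable s ↔ s ∈ L := by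
  by_cases h : s ∈ L <;> simp [Pref.Acceptable, Pref.restrict, Pref.restrictClass, h]

theorem Pref.restrict_weak {S : Type v} (P : Pref S) {L : Set S} {s t : S} (hs : s ∈ L)
    (ht : t ∈ L) : (P.restrict L).weak (some s) (some t) ↔ P.weak (some s) (some t) := by
  simp [Pref.weak, Pref.restrict, Pref.restrictClass, hs, ht]

/-! ### Targets as functions of the rejections -/

namespace DeferredAcceptance

variable {S : Type v} [Fintype S]

theorem target_eq_some_iff {P : Pref S} {rej : Finset S} {s : S} :
    target P rej = some s ↔ P.Acceptable s ∧ s ∉ rej ∧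
      ∀ s', P.Acceptable s' → s' ∉ rej → P.weak (some s) (some s') := by
  unfold target
  constructor
  · intro h
    split at h
    · rename_i hx
      obtain rfl := Option.some.inj h
      exact hx.choose_spec
    · simp at h
  · intro h
    have hx : ∃ s, P.Acceptable s ∧ s ∉ rej ∧
      ∀ s', P.Acceptable s' → s' ∉ rej → P.weak (some s) (some s') := ⟨s, h⟩
    rw [dif_pos hx]
    obtain ⟨h1, h2, h3⟩ := hx.choose_spec
    exact P.weak_antisymm (h3 s h.1 h.2.1) (h.2.2 _ h1 h2)

/-- By definition `target` is also `none` when there is no best remaining school; finiteness of `S`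
excludes that case. -/
theorem target_eq_none_iff {P : Pref S} {rej : Finset S} :
    target P rej = none ↔ ∀ s, P.Acceptable s → s ∈ rej := by
  constructor
  · intro h s hs
    by_contra hr
    have best : ∀ F : Finset S, F.Nonempty → ∃ a ∈ F, ∀ b ∈ F, P.weak (some a) (some b) := by
      intro F hF
      induction hF using Finset.Nonempty.cons_induction with
      | singleton a => exact ⟨a, by simp, by simp [Pref.weak]⟩
      | cons a F ha hF ih =>
        obtain ⟨b, hb, hbest⟩ := ih
        rcases P.weak_or_rel (some a) (some b) with h1 | h1
        · refine ⟨a, by simp, fun c hc => ?_⟩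
          rcases Finset.mem_cons.1 hc with rfl | hc
          · exact P.weak_refl _
          · exact P.weak_trans h1 (hbest c hc)
        · refine ⟨b, by simp [hb], fun c hc => ?_⟩
          rcases Finset.mem_cons.1 hc with rfl | hc
          · exact Or.inl h1
          · exact hbest c hc
    obtain ⟨a, ha, hbest⟩ := best (Finset.univ.filter fun t => P.Acceptable t ∧ t ∉ rej)
      ⟨s, by simp [hs, hr]⟩
    simp only [Finset.mem_filter, Finset.mem_univ, true_and] at ha hbest
    have := target_eq_some_iff.2 ⟨ha.1, ha.2, fun t h1 h2 => hbest t ⟨h1, h2⟩⟩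
    rw [h] at this
    simp at this
  · intro h
    cases ht : target P rej with
    | none => rfl
    | some s =>
      rw [target_eq_some_iff] at ht
      exact absurd (h s ht.1) ht.2.1

theorem target_weak_none (P : Pref S) (rej : Finset S) : P.weak (target P rej) none := by
  cases h : target P rej with
  | none => exact P.weak_refl _
  | some s => exact Or.inl (target_eq_some_iff.1 h).1

theorem mem_of_rel_target {P : Pref S} {rej : Finset S} {s : S}
    (h : P.rel (some s) (target P rej)) : s ∈ rej := by
  have hacc : P.Acceptable s := by
    rcases target_weak_none P rej with h1 | h1
    · exact P.rel_trans h h1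
    · rwa [h1] at h
  by_contra hr
  cases ht : target P rej with
  | none => exact hr (target_eq_none_iff.1 ht s hacc)
  | some t =>
    rw [ht] at h
    exact P.not_rel_self _ (P.rel_of_weak_of_rel ((target_eq_some_iff.1 ht).2.2 s hacc hr) h)

/-- Further rejections only remove competitors of the target, so it stays best until it rejects the
student itself. Hence no one ever leaves a cumulative pool. -/
theorem target_mono {P : Pref S} {rej rej' : Finset S} (h : rej ⊆ rej') {s : S}
    (ht : target P rej = some s) : target P rej' = some s ∨ s ∈ rej' := by
  by_cases hs : s ∈ rej'
  · exact Or.inr hs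
  · rw [target_eq_some_iff] at ht
    exact Or.inl (target_eq_some_iff.2 ⟨ht.1, hs, fun t h1 h2 => ht.2.2 t h1 fun h3 => h2 (h h3)⟩)

end DeferredAcceptance

/-! ### Substitutable and verifiable choice rules -/

section Choice

variable {I : Type u} {S : Type v} {M : Type w} [Fintype I] [Fintype M]
  {E : Economy I S M} {s : S}

namespace ChoiceRule

variable (C : ChoiceRule E s)

theorem seatType_eq_some_iff {A : Finset I} {i : I} {t : SeatType} :
    C.seatType A i = some t ↔ ∃ h : i ∈ A, (C A).seat ⟨i, h⟩ = some ((), t) := by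
  unfold seatType
  split
  · rename_i h
    simp only [Option.map_eq_some_iff, h, exists_true_left]
    constructor
    · rintro ⟨⟨⟨⟩, _⟩, h1, rfl⟩
      exact h1
    · exact fun h1 => ⟨_, h1, rfl⟩
  · rename_i h
    simp [h]

theorem mem_chosen_iff {A : Finset I} {i : I} :
    i ∈ C.chosen A ↔ ∃ t, C.seatType A i = some t := by
  simp [chosen, Option.ne_none_iff_exists']

theorem mem_chosen_iff_school {A : Finset I} {i : I} :
    i ∈ C.chosen A ↔ ∃ h : i ∈ A, (C A).school ⟨i, h⟩ = some () := by
  simp only [mem_chosen_iff, seatType_eq_some_iff, AugMatching.school, Option.map_eq_some_iff]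
  constructor
  · rintro ⟨t, h, h1⟩
    exact ⟨h, _, h1, trivial⟩
  · rintro ⟨h, ⟨⟨⟩, t⟩, h1, -⟩
    exact ⟨t, h, h1⟩

theorem chosen_subset (A : Finset I) : C.chosen A ⊆ A := fun i h => by
  obtain ⟨h1, -⟩ := C.mem_chosen_iff_school.1 h
  exact h1

theorem chosen_eq_map (A : Finset I) :
    C.chosen A = ((C A).admitted ()).map (Function.Embedding.subtype _) := by
  ext i
  simp [mem_chosen_iff, seatType_eq_some_iff, AugMatching.admitted]
  exact exists_comm

theorem card_chosen_le (A : Finset I) : (C.chosen A).card ≤ E.capacity s := by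
  rw [chosen_eq_map, Finset.card_map]
  exact (C A).card_le_capacity ()

variable {C}

theorem Verifiable.bestAffordable (hC : C.Verifiable) (A : Finset I) :
    (C A).BestAffordable fun _ => Pref.accept :=
  hC.elim (fun h => (h A).1) fun h => (h A).1

/-- Under a verifiable rule, an applicant is chosen iff the school is affordable to her. -/
theorem Verifiable.mem_chosen_iff_affordable (hC : C.Verifiable) {A : Finset I} {i : I}
    (hi : i ∈ A) : i ∈ C.chosen A ↔ some () ∈ (C A).affordable ⟨i, hi⟩ := by
  obtain ⟨h1, h2⟩ := hC.bestAffordable A ⟨i, hi⟩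
  rw [mem_chosen_iff_school]
  constructor
  · rintro ⟨h, h3⟩
    rwa [h3] at h1
  · intro h
    refine ⟨hi, ?_⟩
    rcases h2 _ h with ⟨h3, -⟩ | h3
    exacts [h3, h3]

theorem Verifiable.chosen_eq_or_card_eq (hC : C.Verifiable) (A : Finset I) :
    C.chosen A = A ∨ (C.chosen A).card = E.capacity s := by
  by_cases h : (C.chosen A).card = E.capacity s
  · exact Or.inr h
  · refine Or.inl ((C.chosen_subset A).antisymm fun i hi => ?_)
    rw [hC.mem_chosen_iff_affordable hi]
    rw [chosen_eq_map, Finset.card_map] at h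
    rintro ⟨⟩ -
    -- Below capacity the open cutoff is 0, so the school is affordable to every applicant.
    have : (C A).openCutoff () = 0 := if_neg h
    simp [this]

/-- The law of aggregate demand. -/
theorem Verifiable.card_chosen_mono (hC : C.Verifiable) {A B : Finset I} (h : A ⊆ B) :
    (C.chosen A).card ≤ (C.chosen B).card := by
  rcases hC.chosen_eq_or_card_eq B with h1 | h1
  · rw [h1]
    exact Finset.card_le_card ((C.chosen_subset A).trans h)
  · rw [h1]
    exact C.card_chosen_le A

theorem Substitutable.mem_chosen_of_subset (hC : C.Substitutable) {A B : Finset I} (h : A ⊆ B)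
    {i : I} (hi : i ∈ A) (hB : i ∈ C.chosen B) : i ∈ C.chosen A := by
  induction B using Finset.strongInduction with
  | H B ih =>
    rcases h.eq_or_ssubset with rfl | hs
    · exact hB
    -- The members of `B` outside `A` are removed one at a time.
    · obtain ⟨j, hj, hjA⟩ := Finset.exists_of_ssubset hs
      refine ih (B.erase j) (Finset.erase_ssubset hj)
        (fun a ha => Finset.mem_erase.2 ⟨fun e => hjA (e ▸ ha), h ha⟩) ?_
      exact hC B i j (h hi) hj (fun e => hjA (e ▸ hi)) hB

/-- Irrelevance of rejected applicants. -/
theorem chosen_eq_of_subset (hC : C.Substitutable) (hV : C.Verifiable) {A B : Finset I}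
    (h : C.chosen B ⊆ A) (hAB : A ⊆ B) : C.chosen A = C.chosen B :=
  -- Substitutability gives one inclusion, and aggregate demand the cardinality bound that makes it
  -- an equality.
  (Finset.eq_of_subset_of_card_le (fun _ hi => hC.mem_chosen_of_subset hAB (h hi) hi)
    (hV.card_chosen_mono hAB)).symm

end ChoiceRule

/-! ### Cutoffs and seats of a single school -/

namespace AugMatching

theorem ext_seat {μ ν : AugMatching E} (h : ∀ i, μ.seat i = ν.seat i) : μ = ν := by
  cases μ
  cases ν
  congr
  exact funext h

theorem school_eq_some_iff (μ : AugMatching E) {i : I} :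
    μ.school i = some s ↔ ∃ t, μ.seat i = some (s, t) := by
  simp only [school, Option.map_eq_some_iff]
  constructor
  · rintro ⟨⟨_, t⟩, h, rfl⟩
    exact ⟨t, h⟩
  · rintro ⟨t, h⟩
    exact ⟨_, h, rfl⟩

/-- The seats of `s` under `μ` are those of the matching `ν` of the artificial economy. -/
def AgreesAt {A : Finset I} (μ : AugMatching E) (s : S) (ν : AugMatching (E.single s A)) : Prop :=
  ∀ i t, μ.seat i = some (s, t) ↔ ∃ h : i ∈ A, ν.seat ⟨i, h⟩ = some ((), t)

variable {A : Finset I} {μ : AugMatching E} {ν : AugMatching (E.single s A)}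

/-- Cutoffs depend only on the occupants of the seats. Rejected applicants may belong to `A` without
affecting them, which is what lets affordability be tested for those students too. -/
theorem AgreesAt.openCutoff_eq (h : μ.AgreesAt s ν) : μ.openCutoff s = ν.openCutoff () := by
  have h1 : μ.admitted s = (ν.admitted ()).map (Function.Embedding.subtype _) := by
    ext i
    simp [admitted, h i]
    exact exists_comm
  have h2 : μ.openAt s = (ν.openAt ()).map (Function.Embedding.subtype _) := by
    ext i
    simp [openAt, h i]
  unfold openCutoff
  rw [h1, h2, Finset.card_map, Finset.inf_map]
  rfl

theorem AgreesAt.reservedCutoff_eq (h : μ.AgreesAt s ν) (m : M) :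
    μ.reservedCutoff s m = ν.reservedCutoff () m := by
  have h2 : μ.reservedAt s m = (ν.reservedAt () m).map (Function.Embedding.subtype _) := by
    ext i
    simp only [reservedAt, h i, Finset.mem_filter, Finset.mem_univ, true_and, Finset.mem_map]
    constructor
    · rintro ⟨⟨hA, h1⟩, h3⟩
      exact ⟨⟨i, hA⟩, ⟨h1, h3⟩, rfl⟩
    · rintro ⟨⟨j, hA⟩, ⟨h1, h3⟩, rfl⟩
      exact ⟨⟨hA, h1⟩, h3⟩
  unfold reservedCutoff
  rw [h2, Finset.card_map, Finset.inf_map]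
  rfl

theorem AgreesAt.affordable_iff (h : μ.AgreesAt s ν) {i : I} (hi : i ∈ A) :
    some s ∈ μ.affordable i ↔ some () ∈ ν.affordable ⟨i, hi⟩ := by
  constructor
  · rintro h1 ⟨⟩ -
    have h2 := h1 s rfl
    rwa [h.openCutoff_eq, h.reservedCutoff_eq] at h2
  · rintro h1 s' h2
    obtain rfl := Option.some.inj h2
    rw [h.openCutoff_eq, h.reservedCutoff_eq]
    exact h1 () rfl

theorem AgreesAt.roSeatsAt (h : μ.AgreesAt s ν) (hν : ν.ROSeatsAt ()) : μ.ROSeatsAt s := by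
  intro i t hi
  obtain ⟨hA, h1⟩ := (h i t).1 hi
  rw [h.reservedCutoff_eq]
  exact hν _ t h1

theorem AgreesAt.orSeatsAt (h : μ.AgreesAt s ν) (hν : ν.ORSeatsAt ()) : μ.ORSeatsAt s := by
  intro i t hi
  obtain ⟨hA, h1⟩ := (h i t).1 hi
  rw [h.openCutoff_eq]
  exact hν _ t h1

theorem ROSeatsAt.seat_reserved_iff {μ : AugMatching E} (h : μ.ROSeatsAt s) {i : I} :
    μ.seat i = some (s, SeatType.reserved) ↔
      i ∈ μ.admitted s ∧ μ.reservedCutoff s (E.type i) ≤ (E.score i s : ℕ∞) := by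
  simp only [admitted, Finset.mem_filter, Finset.mem_univ, true_and]
  constructor
  · intro h1
    refine ⟨⟨_, h1⟩, ?_⟩
    have := h i _ h1
    by_contra hc
    simp [hc] at this
  · rintro ⟨⟨t, h1⟩, h2⟩
    have := h i _ h1
    rw [if_pos h2] at this
    rw [h1, this]

/-- Under the RO seat rule, the students admitted to a school determine who of them have reserved
seats. -/
theorem ROSeatsAt.reserved_of_reserved {μ ν : AugMatching E} (hμ : μ.ROSeatsAt s)
    (hν : ν.ROSeatsAt s) (had : μ.admitted s = ν.admitted s) {i : I}
    (hi : μ.seat i = some (s, SeatType.reserved)) : ν.seat i = some (s, SeatType.reserved) := by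
  by_contra hc
  have hi' := hμ.seat_reserved_iff.1 hi
  have hlt : (E.score i s : ℕ∞) < ν.reservedCutoff s (E.type i) := by
    by_contra h
    exact hc (hν.seat_reserved_iff.2 ⟨had ▸ hi'.1, not_lt.1 h⟩)
  -- Every type-mate with a reserved seat under `ν` meets a cutoff above the score of `i`, so she
  -- also meets the cutoff of `μ`. The quota is thus unfilled under `ν`, its cutoff there is 0, and
  -- `i` meets it after all.
  have hsub : ν.reservedAt s (E.type i) ⊂ μ.reservedAt s (E.type i) := by
    rw [Finset.ssubset_iff_of_subset]
    · exact ⟨i, by simp [reservedAt, hi], by simp [reservedAt, hc]⟩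
    · intro j hj
      simp only [reservedAt, Finset.mem_filter, Finset.mem_univ, true_and] at hj ⊢
      have h1 := hν.seat_reserved_iff.1 hj.1
      refine ⟨hμ.seat_reserved_iff.2 ⟨had ▸ h1.1, ?_⟩, hj.2⟩
      rw [hj.2] at h1 ⊢
      exact hi'.2.trans (hlt.le.trans h1.2)
  have hcard := (Finset.card_lt_card hsub).trans_le (μ.card_le_reserve s (E.type i))
  have : ν.reservedCutoff s (E.type i) = 0 := by
    unfold reservedCutoff
    rw [if_neg (by omega), if_neg hcard.ne]
  simp [this] at hlt

theorem eq_of_roSeatsAt {μ ν : AugMatching E} (hμ : ∀ s, μ.ROSeatsAt s) (hν : ∀ s, ν.ROSeatsAt s)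
    (h : ∀ i, μ.school i = ν.school i) : μ = ν := by
  have had : ∀ s, μ.admitted s = ν.admitted s := by
    intro s
    ext i
    simp only [admitted, Finset.mem_filter, Finset.mem_univ, true_and, ← school_eq_some_iff, h]
  refine ext_seat fun i => ?_
  have hs := h i
  rcases h1 : μ.seat i with _ | ⟨s, t⟩ <;> rcases h2 : ν.seat i with _ | ⟨s', t'⟩ <;>
    simp only [school, h1, h2, Option.map_none, Option.map_some, reduceCtorEq,
      Option.some.injEq] at hs ⊢
  subst hs
  cases t <;> cases t'
  · rfl
  · have := (hμ s).reserved_of_reserved (hν s) (had s) h1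
    simp_all
  · have := (hν s).reserved_of_reserved (hμ s) (had s).symm h2
    simp_all
  · rfl

end AugMatching

end Choice

/-! ### Rejections in cumulative deferred acceptance -/

namespace DeferredAcceptance

variable {I : Type u} {S : Type v} {M : Type w} [Fintype I] [Fintype S] [Fintype M]
  {E : Economy I S M} {C : ∀ s, ChoiceRule E s} {P : I → Pref S} {rej : I → Finset S}

theorem mem_cumulativePool {s : S} {i : I} :
    i ∈ cumulativePool P rej s ↔ target (P i) (rej i) = some s ∨ s ∈ rej i := by
  simp [cumulativePool]

theorem mem_currentPool {s : S} {i : I} :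
    i ∈ currentPool P rej s ↔ target (P i) (rej i) = some s := by
  simp [currentPool]

theorem cumulativePool_mono {rej' : I → Finset S} (h : ∀ i, rej i ⊆ rej' i) (s : S) :
    cumulativePool P rej s ⊆ cumulativePool P rej' s := by
  intro i hi
  rw [mem_cumulativePool] at hi ⊢
  rcases hi with hi | hi
  · exact target_mono (h i) hi
  · exact Or.inr (h i hi)

theorem assign_seat_eq_some_iff {pool : S → Finset I} {tgt : I → Option S} {i : I} {s : S}
    {t : SeatType} : (assign C pool tgt).seat i = some (s, t) ↔
      tgt i = some s ∧ (C s).seatType (pool s) i = some t := by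
  simp only [assign, Option.bind_eq_some_iff, Option.map_eq_some_iff, Prod.mk.injEq]
  constructor
  · rintro ⟨_, h, _, h', rfl, rfl⟩
    exact ⟨h, h'⟩
  · rintro ⟨h, h'⟩
    exact ⟨s, h, t, h', rfl, rfl⟩

theorem assign_school_eq_some_iff {pool : S → Finset I} {tgt : I → Option S} {i : I} {s : S} :
    (assign C pool tgt).school i = some s ↔ tgt i = some s ∧ i ∈ (C s).chosen (pool s) := by
  rw [AugMatching.school_eq_some_iff, ChoiceRule.mem_chosen_iff]
  simp only [assign_seat_eq_some_iff, exists_and_left]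

/-- `assign` discards chosen students whose target lies elsewhere; if there are none, the school's
own matching survives intact. -/
theorem assign_agreesAt {pool : S → Finset I} {tgt : I → Option S} {s : S}
    (h : ∀ i ∈ (C s).chosen (pool s), tgt i = some s) :
    (assign C pool tgt).AgreesAt s (C s (pool s)) := by
  intro i t
  rw [assign_seat_eq_some_iff, ← ChoiceRule.seatType_eq_some_iff]
  exact ⟨And.right, fun h1 => ⟨h i ((C s).mem_chosen_iff.2 ⟨t, h1⟩), h1⟩⟩

variable (C P rej) in
/-- No school would choose a student whom it has rejected. -/
def RejectionsStand : Prop :=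
  ∀ i s, s ∈ rej i → i ∉ (C s).chosen (cumulativePool P rej s)

variable (C P rej) in
/-- Every student is chosen by her target. -/
def TargetsChosen : Prop :=
  ∀ i s, target (P i) (rej i) = some s → i ∈ (C s).chosen (cumulativePool P rej s)

theorem RejectionsStand.target_eq (h : RejectionsStand C P rej) {i : I} {s : S}
    (hi : i ∈ (C s).chosen (cumulativePool P rej s)) : target (P i) (rej i) = some s :=
  (mem_cumulativePool.1 ((C s).chosen_subset _ hi)).resolve_right fun h1 => h i s h1 hi

theorem mem_round_rejectedBy {pool : Pool I S} {st : State E} {i : I} {s : S} :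
    s ∈ (round pool C P st).rejectedBy i ↔ s ∈ st.rejectedBy i ∨
      target (P i) (st.rejectedBy i) = some s ∧ i ∉ (C s).chosen (pool P st.rejectedBy s) := by
  simp [round]

theorem round_tentative (pool : Pool I S) (C : ∀ s, ChoiceRule E s) (P : I → Pref S)
    (st : State E) : (round pool C P st).tentative =
      assign C (pool P st.rejectedBy) fun i => target (P i) (st.rejectedBy i) := rfl

/-- Anyone rejected by `s` so far was already in the previous pool of `s`, and was not chosen from
it; by substitutability she is not chosen from the larger new pool. -/
theorem RejectionsStand.round (hsub : ∀ s, (C s).Substitutable) {st : State E}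
    (h : RejectionsStand C P st.rejectedBy) :
    RejectionsStand C P (round cumulativePool C P st).rejectedBy := by
  intro i s hi hc
  have hmem : i ∈ cumulativePool P st.rejectedBy s :=
    mem_cumulativePool.2 ((mem_round_rejectedBy.1 hi).elim Or.inr fun h1 => Or.inl h1.1)
  have hc' := (hsub s).mem_chosen_of_subset
    (cumulativePool_mono (fun _ => Finset.subset_union_left) s) hmem hc
  rcases mem_round_rejectedBy.1 hi with h1 | h1
  · exact h i s h1 hc'
  · exact h1.2 hc'

theorem rejectionsStand_iterate (hsub : ∀ s, (C s).Substitutable) (P : I → Pref S) (n : ℕ) :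
    RejectionsStand C P ((step cumulativePool C P)^[n] (State.init E)).rejectedBy := by
  induction n with
  | zero => intro i s h; simp [State.init] at h
  | succ n ih =>
    rw [Function.iterate_succ_apply']
    unfold step
    split
    · exact ih
    · exact ih.round hsub

/-- The algorithm makes only the rejections that every outcome in which students are chosen by
their targets has. -/
theorem rejectedBy_iterate_subset (hsub : ∀ s, (C s).Substitutable)
    (h : TargetsChosen C P rej) (n : ℕ) (i : I) :
    ((step cumulativePool C P)^[n] (State.init E)).rejectedBy i ⊆ rej i := by
  induction n generalizing i with
  | zero => simp [State.init]
  | succ n ih =>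
    rw [Function.iterate_succ_apply']
    unfold step
    split
    · exact ih i
    · intro s hs
      rcases mem_round_rejectedBy.1 hs with h1 | ⟨h1, h2⟩
      · exact ih i h1
      -- Were `s` the target of `i` under `rej`, it would choose her from its pool there, hence also
      -- from the smaller pool of this round, which it did not.
      · refine (target_mono (ih i) h1).resolve_left fun h3 => h2 ?_
        exact (hsub s).mem_chosen_of_subset (cumulativePool_mono ih s)
          (mem_cumulativePool.2 (Or.inl h1)) (h i s h3)

variable (C P) in
/-- The rejections made in the course of cumulative deferred acceptance. -/
noncomputable def finalRejections : I → Finset S := (run cumulativePool C P).rejectedBy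

theorem rejectionsStand_final (hsub : ∀ s, (C s).Substitutable) (P : I → Pref S) :
    RejectionsStand C P (finalRejections C P) := rejectionsStand_iterate hsub P _

theorem finalRejections_subset (hsub : ∀ s, (C s).Substitutable) (h : TargetsChosen C P rej)
    (i : I) : finalRejections C P i ⊆ rej i := rejectedBy_iterate_subset hsub h _ i

/-- A round assigns by the targets before its own rejections. The last round may still reject
students, but only those left with no acceptable school, so recomputing targets and pools afterwards
gives the same matching. -/
theorem round_tentative_eq {st : State E} (h : Stopped P (round cumulativePool C P st)) :
    (round cumulativePool C P st).tentative =
      assign C (cumulativePool P (round cumulativePool C P st).rejectedBy)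
        fun i => target (P i) ((round cumulativePool C P st).rejectedBy i) := by
  set st' := round cumulativePool C P st with hst
  have hsame : ∀ i s, target (P i) (st.rejectedBy i) = some s →
      i ∈ (C s).chosen (cumulativePool P st.rejectedBy s) →
      target (P i) (st'.rejectedBy i) = some s := by
    intro i s h1 h2
    refine (target_mono Finset.subset_union_left h1).resolve_right fun h3 => ?_
    rcases mem_round_rejectedBy.1 h3 with h3 | h3
    · exact target_not_mem h1 h3
    · exact h3.2 h2
  have htgt : ∀ i s, target (P i) (st'.rejectedBy i) = some s ↔
      target (P i) (st.rejectedBy i) = some s ∧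
        i ∈ (C s).chosen (cumulativePool P st.rejectedBy s) := by
    intro i s
    refine ⟨fun h1 => ?_, fun h1 => hsame i s h1.1 h1.2⟩
    rcases h i with h2 | h2
    · obtain ⟨⟨s', t⟩, h2⟩ := Option.ne_none_iff_exists'.1 h2
      have h3 := assign_school_eq_some_iff.1 ((AugMatching.school_eq_some_iff _).2 ⟨t, h2⟩)
      have h4 := hsame i s' h3.1 h3.2
      rw [h1] at h4
      obtain rfl := Option.some.inj h4
      exact h3
    · rw [h1] at h2
      simp at h2
  -- A student rejected in this round stays in the pool: she merely passes from targeting `s` to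
  -- being rejected by it.
  have hpool : ∀ s, cumulativePool P st'.rejectedBy s = cumulativePool P st.rejectedBy s := by
    intro s
    ext i
    rw [mem_cumulativePool, mem_cumulativePool, htgt, hst, mem_round_rejectedBy]
    tauto
  refine AugMatching.ext_seat fun i => Option.ext fun ⟨s, t⟩ => ?_
  rw [round_tentative, assign_seat_eq_some_iff, assign_seat_eq_some_iff, hpool, htgt, ChoiceRule.mem_chosen_iff]
  tauto

theorem cumulativeDA_eq (C : ∀ s, ChoiceRule E s) (P : I → Pref S) :
    cumulativeDA C P = assign C (cumulativePool P (finalRejections C P))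
      fun i => target (P i) (finalRejections C P i) := by
  have key : ∀ n, (step cumulativePool C P)^[n] (State.init E) = State.init E ∨
      ∃ st, (step cumulativePool C P)^[n] (State.init E) = round cumulativePool C P st := by
    intro n
    induction n with
    | zero => exact Or.inl rfl
    | succ n ih =>
      rw [Function.iterate_succ_apply']
      generalize (step cumulativePool C P)^[n] (State.init E) = st at ih ⊢
      unfold step
      split
      · exact ih
      · exact Or.inr ⟨_, rfl⟩
  have hfinal := run_stopped cumulativePool C P
  unfold cumulativeDA finalRejections
  rcases key (Fintype.card I * Fintype.card S + 1) with h | ⟨st, h⟩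
  -- If not even one round is run, no student has an acceptable school and both matchings are empty.
  · change run cumulativePool C P = _ at h
    rw [h] at hfinal ⊢
    refine AugMatching.ext_seat fun i => ?_
    have h1 : target (P i) ((State.init E).rejectedBy i) = none :=
      (hfinal i).resolve_left fun h2 => h2 rfl
    simp only [assign, h1]
    rfl
  · change run cumulativePool C P = _ at h
    rw [h] at hfinal ⊢
    exact round_tentative_eq hfinal

theorem targetsChosen_final (C : ∀ s, ChoiceRule E s) (P : I → Pref S) :
    TargetsChosen C P (finalRejections C P) := by
  intro i s h
  have h1 := (run_stopped cumulativePool C P i).resolve_right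
    fun h2 => by rw [finalRejections, h2] at h; simp at h
  obtain ⟨⟨s', t⟩, h1⟩ := Option.ne_none_iff_exists'.1 h1
  have h2 := (AugMatching.school_eq_some_iff _).2 ⟨t, h1⟩
  change (cumulativeDA C P).school i = _ at h2
  rw [cumulativeDA_eq, assign_school_eq_some_iff, h] at h2
  obtain ⟨h2, h3⟩ := h2
  obtain rfl := Option.some.inj h2
  exact h3

/-! ### The outcome of cumulative deferred acceptance and its verifiability -/

theorem cumulativeDA_school (C : ∀ s, ChoiceRule E s) (P : I → Pref S) (i : I) :
    (cumulativeDA C P).school i = target (P i) (finalRejections C P i) := by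
  rw [cumulativeDA_eq]
  refine Option.ext fun s => ?_
  rw [assign_school_eq_some_iff]
  exact ⟨And.left, fun h => ⟨h, targetsChosen_final C P i s h⟩⟩

theorem cumulativeDA_individuallyRational (C : ∀ s, ChoiceRule E s) :
    (cumulativeDA C).IndividuallyRational := by
  intro P i
  rw [cumulativeDA_school]
  exact target_weak_none _ _

theorem cumulativeDA_agreesAt (hsub : ∀ s, (C s).Substitutable) (P : I → Pref S) (s : S) :
    (cumulativeDA C P).AgreesAt s (C s (cumulativePool P (finalRejections C P) s)) := by
  rw [cumulativeDA_eq]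
  exact assign_agreesAt fun i hi => (rejectionsStand_final hsub P).target_eq hi

theorem cumulativeDA_bestAffordable (hsub : ∀ s, (C s).Substitutable)
    (hver : ∀ s, (C s).Verifiable) (P : I → Pref S) : (cumulativeDA C P).BestAffordable P := by
  intro i
  have haff : ∀ s, i ∈ cumulativePool P (finalRejections C P) s →
      (some s ∈ (cumulativeDA C P).affordable i ↔
        i ∈ (C s).chosen (cumulativePool P (finalRejections C P) s)) := by
    intro s hi
    rw [(cumulativeDA_agreesAt hsub P s).affordable_iff hi,
      (hver s).mem_chosen_iff_affordable hi]
  rw [cumulativeDA_school]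
  constructor
  · intro s hs
    have h1 := (haff s (mem_cumulativePool.2 (Or.inl hs))).2 (targetsChosen_final C P i s hs)
    exact h1 s rfl
  · intro y hy
    refine ((P i).weak_or_rel _ y).resolve_right fun h => ?_
    cases y with
    | none =>
      exact (P i).not_rel_self _ ((P i).rel_of_weak_of_rel (target_weak_none _ _) h)
    | some s =>
      -- A school preferred to the target has rejected `i`, so she is in its cumulative pool, where
      -- affordability would mean being chosen.
      have hs := mem_of_rel_target h
      exact rejectionsStand_final hsub P i s hs ((haff s (mem_cumulativePool.2 (Or.inr hs))).1 hy)

/-! ### Strategy-proofness -/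

/-- With fewer rejections and no new targets every pool shrinks, and substitutability keeps the
students chosen. This supplies the families to which minimality of the DA rejections is applied. -/
theorem TargetsChosen.of_target (hsub : ∀ s, (C s).Substitutable) (h : TargetsChosen C P rej)
    {Q : I → Pref S} {rej' : I → Finset S} (hrej : ∀ j, rej' j ⊆ rej j)
    (htgt : ∀ j t, target (Q j) (rej' j) = some t → target (P j) (rej j) = some t) :
    TargetsChosen C Q rej' := by
  intro j t hj
  refine (hsub t).mem_chosen_of_subset ?_ (mem_cumulativePool.2 (Or.inl hj)) (h j t (htgt j t hj))
  intro k hk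
  rw [mem_cumulativePool] at hk ⊢
  exact hk.imp (htgt k t) fun h1 => hrej k h1

/-- The chosen sets are the fibres of the target map, so the schools' choices together count the
matched students. -/
theorem sum_card_chosen (h : TargetsChosen C P rej) (h' : RejectionsStand C P rej) :
    ∑ s, ((C s).chosen (cumulativePool P rej s)).card =
      (Finset.univ.filter fun i => target (P i) (rej i) ≠ none).card := by
  have h1 : ∀ s, (C s).chosen (cumulativePool P rej s) =
      Finset.univ.filter fun i => target (P i) (rej i) = some s := by
    intro s
    ext i
    simp only [Finset.mem_filter, Finset.mem_univ, true_and]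
    exact ⟨fun hi => h'.target_eq hi, h i s⟩
  simp only [h1]
  rw [← Finset.card_biUnion]
  · congr 1
    ext i
    simp [Option.ne_none_iff_exists']
  · intro s _ t _ hst
    refine Finset.disjoint_left.2 fun i hi hi' => hst ?_
    simp only [Finset.mem_filter, Finset.mem_univ, true_and] at hi hi'
    rw [hi] at hi'
    exact Option.some.inj hi'

theorem target_restrict_singleton (P : Pref S) {s : S} {rej : Finset S} (h : s ∉ rej) :
    target (P.restrict {s}) rej = some s := by
  rw [target_eq_some_iff]
  refine ⟨(P.restrict_acceptable _ _).2 rfl, h, fun t ht _ => ?_⟩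
  rw [Pref.restrict_acceptable] at ht
  obtain rfl := ht
  exact Pref.weak_refl _ _

theorem target_restrict_singleton_self (P : Pref S) (s : S) :
    target (P.restrict {s}) {s} = none := by
  rw [target_eq_none_iff]
  intro t ht
  rw [Pref.restrict_acceptable] at ht
  simpa using ht

/-- Truncating a preference at an acceptable school does not change the target if there is one. -/
theorem target_of_target_restrict {P : Pref S} {s t : S} (hs : P.Acceptable s) {rej : Finset S}
    (h : target (P.restrict {u | P.weak (some u) (some s)}) rej = some t) :
    target P rej = some t ∧ P.weak (some t) (some s) := by
  rw [target_eq_some_iff, Pref.restrict_acceptable] at h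
  obtain ⟨h1, h2, h3⟩ := h
  refine ⟨target_eq_some_iff.2 ⟨P.rel_of_weak_of_rel h1 hs, h2, fun u _ hu => ?_⟩, h1⟩
  rcases P.weak_or_rel (some u) (some s) with h4 | h4
  · exact (P.restrict_weak h1 h4).1 (h3 u ((P.restrict_acceptable _ _).2 h4) hu)
  · exact Or.inl (P.rel_of_weak_of_rel h1 h4)

/-- A student gets a school by ranking only that school if she gets it by some report. -/
theorem not_mem_finalRejections_singleton (hsub : ∀ s, (C s).Substitutable) (P : I → Pref S)
    (i : I) (P' R : Pref S) {s : S}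
    (h : target P' (finalRejections C (Function.update P i P') i) = some s) :
    s ∉ finalRejections C (Function.update P i (R.restrict {s})) i := by
  -- The witness keeps the others' rejections from the report `P'` and clears those of `i`, who then
  -- targets `s` as before.
  have hclosed : TargetsChosen C (Function.update P i (R.restrict {s}))
      (Function.update (finalRejections C (Function.update P i P')) i ∅) := by
    refine (targetsChosen_final C (Function.update P i P')).of_target hsub ?_ ?_
    · intro j
      rcases eq_or_ne j i with rfl | hj
      · simp
      · simp [hj]
    · intro j t ht
      rcases eq_or_ne j i with rfl | hj
      · simp only [Function.update_self] at ht ⊢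
        rwa [← ht, target_restrict_singleton R (by simp)]
      · simpa [hj] using ht
  intro hs
  simpa using finalRejections_subset hsub hclosed i hs

/-- A student who truncates her true preference at a school better than her assignment remains
unmatched. -/
theorem target_truncation_eq_none (hsub : ∀ s, (C s).Substitutable) (P : I → Pref S) (i : I)
    {s : S} (h : (P i).rel (some s) (target (P i) (finalRejections C P i))) :
    target ((P i).restrict {u | (P i).weak (some u) (some s)}) (finalRejections C
      (Function.update P i ((P i).restrict {u | (P i).weak (some u) (some s)})) i) = none := by
  have hs : (P i).Acceptable s := by
    rcases target_weak_none (P i) (finalRejections C P i) with h1 | h1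
    · exact (P i).rel_trans h h1
    · rwa [h1] at h
  set T := (P i).restrict {u | (P i).weak (some u) (some s)} with hT
  cases ht : target T (finalRejections C (Function.update P i T) i) with
  | none => rfl
  | some t =>
    exfalso
    obtain ⟨h1, h2⟩ := target_of_target_restrict hs ht
    -- If `i` were matched under the truncation, all targets would be the same for her true
    -- preference. By minimality the truthful run would then make no further rejections, although it
    -- has `s` and everything better reject her.
    have hclosed : TargetsChosen C P (finalRejections C (Function.update P i T)) := by
      refine (targetsChosen_final C (Function.update P i T)).of_target hsub
        (fun _ => Finset.Subset.refl _) ?_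
      intro j u hu
      rcases eq_or_ne j i with rfl | hj
      · rw [Function.update_self, ht, ← h1, hu]
      · simpa [hj] using hu
    have h3 := mem_of_rel_target ((P i).rel_of_weak_of_rel h2 h)
    exact target_not_mem h1 (finalRejections_subset hsub hclosed i h3)

theorem cumulativeDA_strategyProof (hsub : ∀ s, (C s).Substitutable)
    (hver : ∀ s, (C s).Verifiable) : (cumulativeDA C).StrategyProof := by
  intro P i P'
  rw [cumulativeDA_school, cumulativeDA_school, Function.update_self]
  refine ((P i).weak_or_rel _ _).resolve_right fun h => ?_
  cases hs : target P' (finalRejections C (Function.update P i P') i) with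
  | none =>
    rw [hs] at h
    exact (P i).not_rel_self _ ((P i).rel_of_weak_of_rel (target_weak_none _ _) h)
  | some s =>
  rw [hs] at h
  have hone := not_mem_finalRejections_singleton hsub P i P' (P i) hs
  have hnone := target_truncation_eq_none hsub P i h
  set T := (P i).restrict {u | (P i).weak (some u) (some s)} with hT
  set O := (P i).restrict {s} with hO
  set ρ := finalRejections C (Function.update P i T) with hρ
  set σ := finalRejections C (Function.update P i O) with hσ
  have hsρ : s ∈ ρ i := target_eq_none_iff.1 hnone s
    (((P i).restrict_acceptable _ _).2 ((P i).weak_refl _))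
  -- Under `O` the single rejection by `s` exhausts the list of `i`, so replacing `ρ i` by `{s}`
  -- leaves her without a target, as under `T`. Minimality of `σ` then applies to this family.
  have htgt : ∀ j t, target (Function.update P i O j) (Function.update ρ i {s} j) = some t →
      target (Function.update P i T j) (ρ j) = some t := by
    intro j t ht
    rcases eq_or_ne j i with rfl | hj
    · rw [Function.update_self, Function.update_self, hO, target_restrict_singleton_self] at ht
      simp at ht
    · simpa [hj] using ht
  have hrej : ∀ j, Function.update ρ i {s} j ⊆ ρ j := by
    intro j
    rcases eq_or_ne j i with rfl | hj
    · simpa using hsρ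
    · simp [hj]
  have hle : ∀ j, σ j ⊆ Function.update ρ i {s} j := finalRejections_subset hsub
    ((targetsChosen_final C (Function.update P i T)).of_target hsub hrej htgt)
  have hpool : ∀ t, cumulativePool (Function.update P i O) σ t ⊆
      cumulativePool (Function.update P i T) ρ t := by
    intro t
    refine (cumulativePool_mono hle t).trans fun j hj => ?_
    rw [mem_cumulativePool] at hj ⊢
    exact hj.imp (htgt j t) fun h1 => hrej j h1
  have hcard := Finset.sum_le_sum fun t (_ : t ∈ Finset.univ) =>
    (hver t).card_chosen_mono (hpool t)
  rw [sum_card_chosen (targetsChosen_final C _) (rejectionsStand_final hsub _),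
    sum_card_chosen (targetsChosen_final C _) (rejectionsStand_final hsub _)] at hcard
  -- Students matched under `T` stay matched under `O`, where they face fewer rejections, and `i` is
  -- matched only under `O`.
  refine absurd hcard (not_le.2 (Finset.card_lt_card ?_))
  rw [Finset.ssubset_iff_of_subset]
  · refine ⟨i, ?_, ?_⟩
    · simp only [Finset.mem_filter, Finset.mem_univ, true_and, Function.update_self]
      rw [← hσ, hO, target_restrict_singleton (P i) hone]
      simp
    · simpa only [Finset.mem_filter, Finset.mem_univ, true_and, Function.update_self,
        not_not] using hnone
  · intro j hj
    simp only [Finset.mem_filter, Finset.mem_univ, true_and] at hj ⊢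
    rcases eq_or_ne j i with rfl | hji
    · rw [Function.update_self] at hj
      exact absurd hnone hj
    · intro h1
      rw [Function.update_of_ne hji] at hj h1
      refine hj (target_eq_none_iff.2 fun t ht => ?_)
      exact hrej j (hle j (target_eq_none_iff.1 h1 t ht))

/-! ### Round-by-round deferred acceptance -/

/-- With irrelevance of rejected applicants, it does not matter whether the rejected ones remain in
the pool. -/
theorem chosen_currentPool (hsub : ∀ s, (C s).Substitutable) (hver : ∀ s, (C s).Verifiable)
    (h : RejectionsStand C P rej) (s : S) :
    (C s).chosen (currentPool P rej s) = (C s).chosen (cumulativePool P rej s) :=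
  ChoiceRule.chosen_eq_of_subset (hsub s) (hver s)
    (fun _ hi => mem_currentPool.2 (h.target_eq hi))
    fun _ hi => mem_cumulativePool.2 (Or.inl (mem_currentPool.1 hi))

/-- Stopping depends only on who is matched, not on the seat types, in which the two algorithms may
differ. -/
theorem stopped_congr {st st' : State E} (h : st.rejectedBy = st'.rejectedBy)
    (h' : ∀ i, st.tentative.school i = st'.tentative.school i) : Stopped P st ↔ Stopped P st' := by
  refine forall_congr' fun i => ?_
  have h1 := congrArg (· = none) (h' i)
  simp only [AugMatching.school, Option.map_eq_none_iff] at h1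
  rw [h, Ne, Ne, h1]

theorem iterate_currentPool (hsub : ∀ s, (C s).Substitutable) (hver : ∀ s, (C s).Verifiable)
    (P : I → Pref S) (n : ℕ) :
    ((step currentPool C P)^[n] (State.init E)).rejectedBy =
        ((step cumulativePool C P)^[n] (State.init E)).rejectedBy ∧
      ∀ i, ((step currentPool C P)^[n] (State.init E)).tentative.school i =
        ((step cumulativePool C P)^[n] (State.init E)).tentative.school i := by
  induction n with
  | zero => simp only [Function.iterate_zero, id, implies_true, and_self]
  | succ n ih =>
    have hstand := rejectionsStand_iterate hsub P n
    rw [Function.iterate_succ_apply', Function.iterate_succ_apply']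
    generalize (step cumulativePool C P)^[n] (State.init E) = st' at ih hstand ⊢
    generalize (step currentPool C P)^[n] (State.init E) = st at ih ⊢
    have hch := chosen_currentPool hsub hver hstand
    unfold step
    by_cases hs : Stopped P st'
    · rwa [if_pos hs, if_pos ((stopped_congr ih.1 ih.2).2 hs)]
    · rw [if_neg hs, if_neg (mt (stopped_congr ih.1 ih.2).1 hs)]
      constructor
      · funext i
        ext s
        rw [mem_round_rejectedBy, mem_round_rejectedBy, ih.1, hch]
      · intro i
        refine Option.ext fun s => ?_
        rw [round_tentative, round_tentative, assign_school_eq_some_iff, assign_school_eq_some_iff, ih.1, hch]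

theorem roundwiseDA_school (hsub : ∀ s, (C s).Substitutable) (hver : ∀ s, (C s).Verifiable)
    (P : I → Pref S) (i : I) : (roundwiseDA C P).school i = (cumulativeDA C P).school i :=
  (iterate_currentPool hsub hver P _).2 i

theorem roundwiseDA_roSeatsAt (hRO : ∀ s, (C s).ROVerifiable) (P : I → Pref S) (s : S) :
    (roundwiseDA C P).ROSeatsAt s := by
  have key : ∀ n, ((step currentPool C P)^[n] (State.init E)).tentative.ROSeatsAt s := by
    intro n
    induction n with
    | zero => intro i t h; simp [State.init] at h
    | succ n ih =>
      rw [Function.iterate_succ_apply']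
      unfold step
      split
      · exact ih
      -- Everyone in a current pool targets the school, so `assign` discards no one.
      · refine (assign_agreesAt fun i hi => ?_).roSeatsAt ((hRO s _).2 ())
        exact mem_currentPool.1 ((C s).chosen_subset _ hi)
  exact key _

end DeferredAcceptance

theorem mainTheorem7 {I : Type u} {S : Type v} {M : Type w} [Fintype I] [Fintype S] [Fintype M]
    (E : Economy I S M) (C : ∀ s, ChoiceRule E s)
    (hsub : ∀ s, (C s).Substitutable) (hver : ∀ s, (C s).Verifiable) :
    -- the mechanism is individually rational and strategy-proof
    (DeferredAcceptance.cumulativeDA C).IndividuallyRational ∧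
    (DeferredAcceptance.cumulativeDA C).StrategyProof ∧
    -- it is verifiable, with the verification rule that the schools use
    ((∀ s, (C s).ROVerifiable) → (DeferredAcceptance.cumulativeDA C).ROVerifiable) ∧
    ((∀ s, (C s).ORVerifiable) → (DeferredAcceptance.cumulativeDA C).ORVerifiable) ∧
    -- if different schools use different rules, each student verifies with her school's rule
    (∀ P, (DeferredAcceptance.cumulativeDA C P).BestAffordable P ∧
      ∀ s, ((C s).ROVerifiable → (DeferredAcceptance.cumulativeDA C P).ROSeatsAt s) ∧
        ((C s).ORVerifiable → (DeferredAcceptance.cumulativeDA C P).ORSeatsAt s)) ∧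
    -- choosing from new and tentatively admitted applicants only yields the same schools, hence an
    -- individually rational and strategy-proof mechanism, and the same seats under RO rules
    (∀ P i, (DeferredAcceptance.roundwiseDA C P).school i =
      (DeferredAcceptance.cumulativeDA C P).school i) ∧
    (DeferredAcceptance.roundwiseDA C).IndividuallyRational ∧
    (DeferredAcceptance.roundwiseDA C).StrategyProof ∧
    ((∀ s, (C s).ROVerifiable) → DeferredAcceptance.roundwiseDA C =
      DeferredAcceptance.cumulativeDA C ∧ (DeferredAcceptance.roundwiseDA C).ROVerifiable) := by
  have hRO : (∀ s, (C s).ROVerifiable) → (DeferredAcceptance.cumulativeDA C).ROVerifiable :=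
    fun h P => ⟨DeferredAcceptance.cumulativeDA_bestAffordable hsub hver P, fun s =>
      (DeferredAcceptance.cumulativeDA_agreesAt hsub P s).roSeatsAt ((h s _).2 ())⟩
  refine ⟨DeferredAcceptance.cumulativeDA_individuallyRational C,
    DeferredAcceptance.cumulativeDA_strategyProof hsub hver, hRO, fun h P =>
      ⟨DeferredAcceptance.cumulativeDA_bestAffordable hsub hver P, fun s =>
        (DeferredAcceptance.cumulativeDA_agreesAt hsub P s).orSeatsAt ((h s _).2 ())⟩,
    fun P => ⟨DeferredAcceptance.cumulativeDA_bestAffordable hsub hver P, fun s =>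
      ⟨fun h => (DeferredAcceptance.cumulativeDA_agreesAt hsub P s).roSeatsAt ((h _).2 ()),
        fun h => (DeferredAcceptance.cumulativeDA_agreesAt hsub P s).orSeatsAt ((h _).2 ())⟩⟩,
    DeferredAcceptance.roundwiseDA_school hsub hver, fun P i => ?_, fun P i P' => ?_, fun h => ?_⟩
  · rw [DeferredAcceptance.roundwiseDA_school hsub hver]
    exact DeferredAcceptance.cumulativeDA_individuallyRational C P i
  · rw [DeferredAcceptance.roundwiseDA_school hsub hver,
      DeferredAcceptance.roundwiseDA_school hsub hver]
    exact DeferredAcceptance.cumulativeDA_strategyProof hsub hver P i P'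
  · have heq : DeferredAcceptance.roundwiseDA C = DeferredAcceptance.cumulativeDA C :=
      funext fun P => AugMatching.eq_of_roSeatsAt
        (DeferredAcceptance.roundwiseDA_roSeatsAt h P) (hRO h P).2
        (DeferredAcceptance.roundwiseDA_school hsub hver P)
    exact ⟨heq, heq ▸ hRO h⟩
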